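/- Let $\alpha,v,w>0$ be real. Let $\zeta_2(s,\alpha;v,w)$ be the Barnes double zeta function, that is, the analytic continuation to $\mathbb{C}\setminus\{1,2\}$ of $\sum_{m,n\ge 0}(\alpha+mv+nw)^{-s}$ ($\operatorname{Re}s>2$). This continuation exists. Write $\zeta_2^{(k)}(0,\alpha;v,w)$ for its $k$-th derivative with respect to $s$ at $s=0$. For $c\in\{1,2\}$ let $\gamma_k(c,\alpha;v,w)$ be the coefficients of its Laurent expansion at $s=c$, $$\zeta_2(s,\alpha;v,w)=\sum_{k=-1}^{\infty}\gamma_k(c,\alpha;v,w)(s-c)^k\qquad(0<|s-c|<1),$$ which has no terms of order below $-1$. Put $\log\Gamma_2(\alpha;v,w)=\zeta_2'(0,\alpha;v,w)$, so that $\Gamma_2(\alpha;v,w)=\exp(\zeta_2'(0,\alpha;v,w))$, where $\zeta_2'(0,\alpha;v,w)$ is the principal logarithm of $\Gamma_2(\alpha;v,w)$, and $\psi_2^{(k)}(\alpha;v,w)=\frac{\partial^k}{\partial\alpha^k}\log\Gamma_2(\alpha;v,w)$ for $k\ge 0$. All the derivatives with respect to $\alpha$ below exist, and the following hold. (1) For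 every integer $k\ge 0$, $$\gamma_{k-1}(1,\alpha;v,w)=-\frac1{k!}\frac{\partial}{\partial\alpha}\zeta_2^{(k)}(0,\alpha;v,w).$$ In particular $\gamma_{-1}(1,\alpha;v,w)=\dfrac{v+w-2\alpha}{2vw}$ and $\gamma_0(1,\alpha;v,w)=-\dfrac{\partial}{\partial\alpha}\log\Gamma_2(\alpha;v,w)$; moreover, for every integer $k\ge0$, $$\frac{\partial^k}{\partial\alpha^k}\gamma_0(1,\alpha;v,w)=-\frac{\partial}{\partial\alpha}\psi_2^{(k)}(\alpha;v,w).$$ (2) For every integer $k\ge -1$, $$\sum_{l=-1}^{k}(-1)^{k-l+1}\frac{\partial}{\partial\alpha}\gamma_l(1,\alpha;v,w)=\gamma_k(2,\alpha;v,w).$$ -/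

import Mathlib

/-- `Z` is the analytic continuation to `ℂ \ {1, 2}` of the double series
`∑_{m,n ≥ 0} (α + m v + n w)^{-s}`, `Re s > 2`. Such a `Z` is unique off `{1, 2}`, because
`ℂ \ {1, 2}` is connected. -/
def IsBarnesContinuation (α v w : ℝ) (Z : ℂ → ℂ) : Prop :=
  DifferentiableOn ℂ Z {1, 2}ᶜ ∧
    ∀ s : ℂ, 2 < s.re →
      HasSum (fun p : ℕ × ℕ => 1 / ((α + p.1 * v + p.2 * w : ℝ) : ℂ) ^ s) (Z s)

open Classical in
/-- The Barnes double zeta function `ζ₂(s, α; v, w)`, analytically continued in `s`.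
Its values at `s = 1, 2` have no meaning and are never used. -/
noncomputable def barnesZeta (s : ℂ) (α v w : ℝ) : ℂ :=
  if h : ∃ Z : ℂ → ℂ, IsBarnesContinuation α v w Z then h.choose s else 0

/-- The `k`-th Laurent coefficient `γ_k(c, α; v, w)` of `s ↦ ζ₂(s, α; v, w)` at `c` (`c = 1, 2`),
`(2πi)⁻¹ ∮ ζ₂(s) (s - c)^{-k-1} ds`. The circle `|s - c| = 1/2` lies in the punctured disc
`0 < |s - c| < 1`, where `ζ₂` is holomorphic. -/
noncomputable def barnesGamma (k : ℤ) (c : ℂ) (α v w : ℝ) : ℂ :=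
  (2 * Real.pi * Complex.I)⁻¹ *
    ∮ s in C(c, 1 / 2), barnesZeta s α v w / (s - c) ^ (k + 1)

/-- The `k`-th derivative in `s` at `s = 0`, `ζ₂^{(k)}(0, α; v, w)`. -/
noncomputable def barnesZetaDerivZero (k : ℕ) (α v w : ℝ) : ℂ :=
  iteratedDeriv k (fun s : ℂ => barnesZeta s α v w) 0

/-- `log Γ₂(x; v, w) := ζ₂'(0, x; v, w)`. -/
noncomputable def logDoubleGamma (x v w : ℝ) : ℂ :=
  deriv (fun s : ℂ => barnesZeta s x v w) 0

/-- The double gamma function `Γ₂(x; v, w) = exp (ζ₂'(0, x; v, w))`. -/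
noncomputable def doubleGamma (x v w : ℝ) : ℂ :=
  Complex.exp (logDoubleGamma x v w)

/-- The double polygamma function `ψ₂^{(k)}(x; v, w) = (d/dx)^k log Γ₂(x; v, w)`. -/
noncomputable def doublePolygamma (k : ℕ) (x v w : ℝ) : ℂ :=
  iteratedDeriv k (fun y : ℝ => logDoubleGamma y v w) x

open Set Filter Topology MeasureTheory

/-- Parametric interval integrals of jointly continuous functions are continuous. -/
theorem continuousOn_intervalIntegral_of_continuousOn {X : Type*} [TopologicalSpace X]
    {S : Set X} {a b : ℝ} (hab : a ≤ b) {f : X → ℝ → ℂ}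
    (hf : ContinuousOn (Function.uncurry f) (S ×ˢ Icc a b)) :
    ContinuousOn (fun p => ∫ t in a..b, f p t) S := by
  have hg : Continuous (Function.uncurry fun (p : S) (t : ℝ) => f p (projIcc a b hab t)) := by
    refine hf.comp_continuous (f := fun q : S × ℝ => ((q.1 : X), (projIcc a b hab q.2 : ℝ)))
      (by fun_prop) fun q => ⟨q.1.2, (projIcc a b hab q.2).2⟩
  have h := intervalIntegral.continuous_parametric_intervalIntegral_of_continuous' (μ := volume)
    hg a b
  rw [continuousOn_iff_continuous_domRestrict]
  refine h.congr fun p => intervalIntegral.integral_congr fun t ht => ?_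
  rw [uIcc_of_le hab] at ht
  simp [projIcc_of_mem hab ht]

/-- Differentiation under the integral sign over a compact interval, for a jointly continuous
derivative. -/
theorem hasDerivAt_intervalIntegral_of_continuousOn {𝕜 : Type*} [RCLike 𝕜] [NormedSpace 𝕜 ℂ]
    {S : Set 𝕜} (hS : IsOpen S) {a b : ℝ} (hab : a ≤ b) {f f' : 𝕜 → ℝ → ℂ}
    (hf : ∀ x ∈ S, ContinuousOn (f x) (Icc a b))
    (hf' : ContinuousOn (Function.uncurry f') (S ×ˢ Icc a b))
    (hd : ∀ x ∈ S, ∀ t ∈ Icc a b, HasDerivAt (fun y => f y t) (f' x t) x) {x₀ : 𝕜}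
    (hx₀ : x₀ ∈ S) :
    HasDerivAt (fun x => ∫ t in a..b, f x t) (∫ t in a..b, f' x₀ t) x₀ := by
  obtain ⟨K, hK, hxK, hKS⟩ := exists_compact_subset hS hx₀
  obtain ⟨M, hM⟩ := (hK.prod isCompact_Icc).exists_bound_of_continuousOn
    (hf'.mono (prod_mono hKS (subset_refl (Icc a b))))
  have hsub : uIoc a b ⊆ Icc a b := by rw [uIoc_of_le hab]; exact Ioc_subset_Icc_self
  have hf'₀ : ContinuousOn (f' x₀) (Icc a b) :=
    hf'.comp (f := fun t => (x₀, t)) (by fun_prop) fun t ht => ⟨hx₀, ht⟩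
  refine (intervalIntegral.hasDerivAt_integral_of_dominated_loc_of_deriv_le
    (s := interior K) (bound := fun _ => M) (isOpen_interior.mem_nhds hxK) ?_ ?_ ?_ ?_
    intervalIntegrable_const ?_).2
  · filter_upwards [hS.mem_nhds hx₀] with x hx
    exact ((hf x hx).mono hsub).aestronglyMeasurable measurableSet_uIoc
  · exact (by rw [uIcc_of_le hab]; exact hf x₀ hx₀ : ContinuousOn _ (uIcc a b)).intervalIntegrable
  · exact (hf'₀.mono hsub).aestronglyMeasurable measurableSet_uIoc
  · exact ae_of_all _ fun t ht x hx => hM (x, t) ⟨interior_subset hx, hsub ht⟩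
  · exact ae_of_all _ fun t ht x hx => hd x (hKS (interior_subset hx)) t (hsub ht)

/-- The complex derivative of a jointly continuous family of holomorphic functions is jointly
continuous. -/
theorem continuousOn_deriv_of_continuousOn {Y : Type*} [TopologicalSpace Y] {U : Set ℂ}
    (hU : IsOpen U) {T : Set Y} {f : ℂ → Y → ℂ}
    (hf : ContinuousOn (Function.uncurry f) (U ×ˢ T))
    (hd : ∀ t ∈ T, DifferentiableOn ℂ (fun s => f s t) U) :
    ContinuousOn (fun p : ℂ × Y => deriv (fun s => f s p.2) p.1) (U ×ˢ T) := by
  rintro ⟨s₀, t₀⟩ ⟨hs₀, ht₀⟩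
  obtain ⟨r, hr, hrU⟩ := Metric.isOpen_iff.1 hU s₀ hs₀
  have hr4 : 0 < r / 4 := by positivity
  have hmem : ∀ s ∈ Metric.ball s₀ (r / 4), Metric.closedBall s (r / 4) ⊆ U := fun s hs z hz =>
    hrU (by
      rw [Metric.mem_ball] at hs ⊢
      rw [Metric.mem_closedBall] at hz
      linarith [dist_triangle z s s₀])
  have hcirc : ContinuousOn (fun p : ℂ × Y => (2 * Real.pi * Complex.I)⁻¹ *
      ∫ θ in (0 : ℝ)..2 * Real.pi, deriv (circleMap 0 (r / 4)) θ *
        ((circleMap 0 (r / 4) θ ^ 2)⁻¹ * f (p.1 + circleMap 0 (r / 4) θ) p.2))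
      (Metric.ball s₀ (r / 4) ×ˢ T) := by
    refine continuousOn_const.mul
      (continuousOn_intervalIntegral_of_continuousOn Real.two_pi_pos.le ?_)
    have h0 : ∀ θ, circleMap 0 (r / 4) θ ≠ 0 := fun θ => circleMap_ne_center hr4.ne'
    have hcm : Continuous (circleMap 0 (r / 4)) := continuous_circleMap _ _
    simp only [Function.uncurry_def, deriv_circleMap]
    refine ContinuousOn.mul (by fun_prop) (ContinuousOn.mul ?_ ?_)
    · exact (((hcm.comp continuous_snd).pow 2).inv₀ fun q => pow_ne_zero 2 (h0 q.2)).continuousOn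
    · refine hf.comp (f := fun q : (ℂ × Y) × ℝ => (q.1.1 + circleMap 0 (r / 4) q.2, q.1.2))
        (by fun_prop) fun q hq => ⟨hmem q.1.1 hq.1.1 ?_, hq.1.2⟩
      simp [abs_of_pos hr4]
  have hev : U ×ˢ T ∩ Metric.ball s₀ (r / 4) ×ˢ univ ∈ 𝓝[U ×ˢ T] (s₀, t₀) :=
    inter_mem_nhdsWithin _ (prod_mem_nhds (Metric.ball_mem_nhds _ hr4) univ_mem)
  have heq : ∀ p ∈ Metric.ball s₀ (r / 4) ×ˢ T, deriv (fun s => f s p.2) p.1 =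
      (2 * Real.pi * Complex.I)⁻¹ *
      ∫ θ in (0 : ℝ)..2 * Real.pi, deriv (circleMap 0 (r / 4)) θ *
        ((circleMap 0 (r / 4) θ ^ 2)⁻¹ * f (p.1 + circleMap 0 (r / 4) θ) p.2) := by
    rintro ⟨s, t⟩ ⟨hs, ht⟩
    have h := DifferentiableOn.deriv_eq_smul_circleIntegral hr4 ((hd t ht).mono (hmem s hs))
    rw [eq_inv_mul_iff_mul_eq₀ Complex.two_pi_I_ne_zero]
    rw [smul_eq_mul] at h
    rw [← h, circleIntegral]
    simp [circleMap, mul_comm, mul_left_comm]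
  refine ContinuousWithinAt.mono_of_mem_nhdsWithin
    (t := Metric.ball s₀ (r / 4) ×ˢ T) ?_ (mem_of_superset hev fun q hq => ⟨hq.2.1, hq.1.2⟩)
  exact (hcirc.congr heq) _ ⟨Metric.mem_ball_self hr4, ht₀⟩

/-- An integral over a compact interval of a jointly continuous family of holomorphic functions is
holomorphic. -/
theorem differentiableOn_intervalIntegral_of_continuousOn {U : Set ℂ} (hU : IsOpen U) {a b : ℝ}
    (hab : a ≤ b) {f : ℂ → ℝ → ℂ} (hf : ContinuousOn (Function.uncurry f) (U ×ˢ Icc a b))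
    (hd : ∀ t ∈ Icc a b, DifferentiableOn ℂ (fun s => f s t) U) :
    DifferentiableOn ℂ (fun s => ∫ t in a..b, f s t) U := fun s hs =>
  (hasDerivAt_intervalIntegral_of_continuousOn hU hab
    (f' := fun s t => deriv (fun z => f z t) s)
    (fun x hx => hf.comp (f := fun t => (x, t)) (by fun_prop) fun t ht => ⟨hx, ht⟩)
    (continuousOn_deriv_of_continuousOn hU hf hd)
    (fun x hx t ht => ((hd t ht).differentiableAt (hU.mem_nhds hx)).hasDerivAt)
    hs).differentiableAt.differentiableWithinAt

/-- A family `F s x` (`s ∈ U`, `x > 0`), jointly continuous, holomorphic in `s`, with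
`∂F/∂x (s, x) = (c - s) F (s + 1, x)`. -/
structure IsLadder (c : ℂ) (U : Set ℂ) (F : ℂ → ℝ → ℂ) : Prop where
  continuousOn : ContinuousOn (Function.uncurry F) (U ×ˢ Ioi 0)
  differentiableOn : ∀ x, 0 < x → DifferentiableOn ℂ (fun s => F s x) U
  hasDerivAt : ∀ s ∈ U, ∀ x, 0 < x → HasDerivAt (F s) ((c - s) * F (s + 1) x) x

/-- The weighted average `v⁻¹ ∫₀ᵛ (v - t) f (x + t) dt`. -/
noncomputable def rampAverage (v : ℝ) (f : ℝ → ℂ) (x : ℝ) : ℂ :=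
  (v : ℂ)⁻¹ * ∫ t in (0 : ℝ)..v, ((v - t : ℝ) : ℂ) * f (x + t)

theorem rampAverage_congr {v : ℝ} (hv : 0 < v) {f g : ℝ → ℂ} (h : EqOn f g (Ioi 0)) {x : ℝ}
    (hx : 0 < x) : rampAverage v f x = rampAverage v g x := by
  unfold rampAverage
  congr 1
  refine intervalIntegral.integral_congr fun t ht => ?_
  rw [uIcc_of_le hv.le] at ht
  have : x + t ∈ Ioi (0 : ℝ) := add_pos_of_pos_of_nonneg hx ht.1
  simp only [h this]

theorem rampAverage_const {v : ℝ} (hv : 0 < v) (C : ℂ) (x : ℝ) :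
    rampAverage v (fun _ => C) x = v / 2 * C := by
  have h : ∫ t in (0 : ℝ)..v, ((v - t : ℝ) : ℂ) = v ^ 2 / 2 := by
    rw [intervalIntegral.integral_ofReal, intervalIntegral.integral_sub (by simp)
      (by simp), integral_id, intervalIntegral.integral_const]
    push_cast
    simp only [smul_eq_mul]
    push_cast
    ring
  have hv' : (v : ℂ) ≠ 0 := by exact_mod_cast hv.ne'
  rw [rampAverage, intervalIntegral.integral_mul_const, h]
  field_simp

namespace IsLadder

variable {c : ℂ} {U V : Set ℂ} {E F G : ℂ → ℝ → ℂ}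

theorem mono (h : IsLadder c U F) (hV : V ⊆ U) : IsLadder c V F where
  continuousOn := h.continuousOn.mono (prod_mono hV subset_rfl)
  differentiableOn x hx := (h.differentiableOn x hx).mono hV
  hasDerivAt s hs := h.hasDerivAt s (hV hs)

theorem congr (h : IsLadder c U F) (hU : ∀ s ∈ U, s + 1 ∈ U)
    (hG : ∀ s ∈ U, EqOn (G s) (F s) (Ioi 0)) : IsLadder c U G where
  continuousOn := h.continuousOn.congr fun p hp => hG p.1 hp.1 hp.2
  differentiableOn x hx := (h.differentiableOn x hx).congr fun s hs => hG s hs hx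
  hasDerivAt s hs x hx := by
    rw [hG (s + 1) (hU s hs) hx]
    exact (h.hasDerivAt s hs x hx).congr_of_eventuallyEq
      ((hG s hs).eventuallyEq_of_mem (Ioi_mem_nhds hx))

/-- One step of the continuation to the left. -/
theorem step (hE : IsLadder c univ E) (hF : IsLadder c U F) (hUo : IsOpen U)
    (hU : ∀ s ∈ U, s + 1 ∈ U) {v : ℝ} (hv : 0 < v) :
    IsLadder c {s | s + 1 ∈ U} (fun s x => E s x + (s - c) * rampAverage v (F (s + 1)) x) := by
  have hVo : IsOpen {s : ℂ | s + 1 ∈ U} := hUo.preimage (by fun_prop)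
  have hpos : ∀ {x t : ℝ}, 0 < x → t ∈ Icc 0 v → 0 < x + t := fun hx ht =>
    add_pos_of_pos_of_nonneg hx ht.1
  constructor
  · have hE' : ContinuousOn (fun p : ℂ × ℝ => E p.1 p.2) ({s | s + 1 ∈ U} ×ˢ Ioi 0) :=
      hE.continuousOn.mono (prod_mono (subset_univ _) subset_rfl)
    refine hE'.add (ContinuousOn.mul (by fun_prop) (continuousOn_const.mul
      (continuousOn_intervalIntegral_of_continuousOn hv.le ?_)))
    refine ContinuousOn.mul (by fun_prop) ?_
    exact hF.continuousOn.comp (f := fun q : (ℂ × ℝ) × ℝ => (q.1.1 + 1, q.1.2 + q.2))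
      (by fun_prop) fun q hq => ⟨hq.1.1, hpos hq.1.2 hq.2⟩
  · intro x hx
    refine ((hE.differentiableOn x hx).mono (subset_univ _)).add (DifferentiableOn.mul
      (by fun_prop) (DifferentiableOn.const_mul
      (differentiableOn_intervalIntegral_of_continuousOn hVo hv.le ?_ ?_) _))
    · refine ContinuousOn.mul (by fun_prop) ?_
      exact hF.continuousOn.comp (f := fun q : ℂ × ℝ => (q.1 + 1, x + q.2))
        (by fun_prop) fun q hq => ⟨hq.1, hpos hx hq.2⟩
    · intro t ht
      refine DifferentiableOn.const_mul ?_ _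
      exact (hF.differentiableOn _ (hpos hx ht)).comp (f := fun s : ℂ => s + 1) (by fun_prop)
        fun s hs => hs
  · intro s hs x hx
    have hs' : s + 1 ∈ U := hs
    have key : HasDerivAt (fun y => ∫ t in (0 : ℝ)..v, ((v - t : ℝ) : ℂ) * F (s + 1) (y + t))
        (∫ t in (0 : ℝ)..v, ((v - t : ℝ) : ℂ) * ((c - (s + 1)) * F (s + 1 + 1) (x + t))) x := by
      refine hasDerivAt_intervalIntegral_of_continuousOn (𝕜 := ℝ) isOpen_Ioi hv.le
        (f' := fun y t => ((v - t : ℝ) : ℂ) * ((c - (s + 1)) * F (s + 1 + 1) (y + t)))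
        ?_ ?_ ?_ (mem_Ioi.2 hx)
      · intro y hy
        refine ContinuousOn.mul (by fun_prop) ?_
        exact hF.continuousOn.comp (f := fun t : ℝ => (s + 1, y + t)) (by fun_prop)
          fun t ht => ⟨hs, hpos hy ht⟩
      · refine ContinuousOn.mul (by fun_prop) (continuousOn_const.mul ?_)
        exact hF.continuousOn.comp (f := fun q : ℝ × ℝ => (s + 1 + 1, q.1 + q.2)) (by fun_prop)
          fun q hq => ⟨hU _ hs, hpos hq.1 hq.2⟩
      · intro y hy t ht
        exact ((hF.hasDerivAt (s + 1) hs' (y + t) (hpos hy ht)).comp_add_const y t).const_mul _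
    have h := (hE.hasDerivAt s (mem_univ _) x hx).add
      ((key.const_mul (v : ℂ)⁻¹).const_mul (s - c))
    refine h.congr_deriv ?_
    simp only [rampAverage, mul_left_comm _ (c - (s + 1)), intervalIntegral.integral_const_mul]
    ring

theorem isOpen_re_gt (σ : ℝ) : IsOpen {s : ℂ | σ < s.re} :=
  isOpen_lt continuous_const Complex.continuous_re

/-- A ladder on a right half-plane satisfying the averaging recursion extends to the plane. -/
theorem exists_extension (hE : IsLadder c univ E) {σ : ℝ} (hF : IsLadder c {s | σ < s.re} F)
    {v : ℝ} (hv : 0 < v)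
    (hrec : ∀ s : ℂ, σ < s.re → ∀ x, 0 < x →
      F s x = E s x + (s - c) * rampAverage v (F (s + 1)) x) :
    ∃ G : ℂ → ℝ → ℂ, IsLadder c univ G ∧
      (∀ s : ℂ, σ < s.re → ∀ x, 0 < x → G s x = F s x) ∧
      ∀ s x, 0 < x → G s x = E s x + (s - c) * rampAverage v (G (s + 1)) x := by
  let S : (ℂ → ℝ → ℂ) → ℂ → ℝ → ℂ := fun H s x => E s x + (s - c) * rampAverage v (H (s + 1)) x
  let T : ℕ → ℂ → ℝ → ℂ := fun n => S^[n] F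
  let W : ℕ → Set ℂ := fun n => {s : ℂ | σ - n < s.re}
  have hT : ∀ n, T (n + 1) = S (T n) := fun n => Function.iterate_succ_apply' S n F
  have hWo : ∀ n, IsOpen (W n) := fun n => isOpen_re_gt _
  have hW1 : ∀ n, ∀ s ∈ W n, s + 1 ∈ W n := fun n s hs => by
    simp only [W, mem_ofPred_eq, Complex.add_re, Complex.one_re] at hs ⊢; linarith
  have hWs : ∀ n s, s ∈ W (n + 1) → s + 1 ∈ W n := fun n s hs => by
    simp only [W, mem_ofPred_eq, Complex.add_re, Complex.one_re, Nat.cast_add, Nat.cast_one] at hs ⊢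
    linarith
  have hWmono : ∀ n m, n ≤ m → W n ⊆ W m := fun n m hnm s hs => by
    have : (n : ℝ) ≤ m := by exact_mod_cast hnm
    simp only [W, mem_ofPred_eq] at hs ⊢; linarith
  have hTl : ∀ n, IsLadder c (W n) (T n) := by
    intro n
    induction n with
    | zero => simpa [W, T] using hF
    | succ n ih =>
      rw [hT]
      exact (hE.step ih (hWo n) (hW1 n) hv).mono fun s hs => hWs n s hs
  have hTsucc : ∀ n, ∀ s ∈ W n, EqOn (T (n + 1) s) (T n s) (Ioi 0) := by
    intro n
    induction n with
    | zero =>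
      intro s hs x hx
      exact (hrec s (by simpa [W] using hs) x hx).symm
    | succ n ih =>
      intro s hs x hx
      have h := rampAverage_congr hv (ih (s + 1) (hWs n s hs)) hx
      rw [hT (n + 1)]
      conv_rhs => rw [hT n]
      simp only [S, h]
  have hTle : ∀ n m, n ≤ m → ∀ s ∈ W n, EqOn (T m s) (T n s) (Ioi 0) := by
    intro n m hnm
    induction m, hnm using Nat.le_induction with
    | base => exact fun s _ x _ => rfl
    | succ m hnm ih =>
      exact fun s hs => (hTsucc m s (hWmono n m hnm hs)).trans (ih s hs)
  let N : ℂ → ℕ := fun s => ⌈σ - s.re⌉₊ + 1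
  have hN : ∀ s, s ∈ W (N s) := fun s => by
    have := Nat.le_ceil (σ - s.re)
    simp only [W, N, mem_ofPred_eq, Nat.cast_add, Nat.cast_one]
    linarith
  let G : ℂ → ℝ → ℂ := fun s => T (N s) s
  have hG : ∀ n, ∀ s ∈ W n, EqOn (G s) (T n s) (Ioi 0) := fun n s hs => by
    rcases le_total n (N s) with h | h
    · exact hTle _ _ h s hs
    · exact fun x hx => (hTle _ _ h s (hN s) hx).symm
  have hGl : ∀ n, IsLadder c (W n) G := fun n => (hTl n).congr (hW1 n) (hG n)
  refine ⟨G, ⟨?_, ?_, ?_⟩, ?_, ?_⟩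
  · rintro ⟨s, x⟩ ⟨-, hx⟩
    exact ((hGl (N s)).continuousOn.continuousAt
      (((hWo _).prod isOpen_Ioi).mem_nhds ⟨hN s, hx⟩)).continuousWithinAt
  · exact fun x hx s _ => (((hGl (N s)).differentiableOn x hx).differentiableAt
      ((hWo _).mem_nhds (hN s))).differentiableWithinAt
  · exact fun s _ => (hGl (N s)).hasDerivAt s (hN s)
  · exact fun s hs x hx => hG 0 s (by simpa [W] using hs) hx
  · intro s x hx
    rw [hG (N s + 1) s (hWmono _ _ (Nat.le_succ _) (hN s)) hx, hT]
    simp only [S]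
    rw [rampAverage_congr hv (hG (N s) (s + 1) (hW1 _ s (hN s))) hx]

end IsLadder

theorem hasDerivAt_ofReal_cpow (r : ℂ) {x : ℝ} (hx : 0 < x) :
    HasDerivAt (fun y : ℝ => (y : ℂ) ^ r) (r * (x : ℂ) ^ (r - 1)) x := by
  have h := ((hasDerivAt_id (x : ℂ)).cpow_const (c := r) (Or.inl (by simpa using hx))).comp_ofReal
  simpa using h

theorem continuousOn_ofReal_cpow_neg :
    ContinuousOn (fun p : ℂ × ℝ => (p.2 : ℂ) ^ (-p.1)) (univ ×ˢ Ioi 0) := by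
  refine ContinuousOn.cpow (by fun_prop) (by fun_prop) fun p hp => Or.inl ?_
  simpa using hp.2

/-- The generalized Dirichlet series `∑ᵢ (x + lᵢ)^{-s}`. -/
noncomputable def shiftedSeries {ι : Type*} (l : ι → ℝ) (s : ℂ) (x : ℝ) : ℂ :=
  ∑' i, ((x + l i : ℝ) : ℂ) ^ (-s)

/-- The shifts `l` are nonnegative and `∑ᵢ (1 + lᵢ)^{-σ}` converges for `σ > c`. -/
structure HasAbscissa {ι : Type*} (l : ι → ℝ) (c : ℝ) : Prop where
  nonneg : ∀ i, 0 ≤ l i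
  summable : ∀ σ, c < σ → Summable fun i => (1 + l i) ^ (-σ)

theorem norm_cpow_shift_le {δ σ R x l : ℝ} {s : ℂ} (hδ : 0 < δ) (hδ1 : δ ≤ 1) (hx : δ ≤ x)
    (hl : 0 ≤ l) (hσ : 0 ≤ σ) (hs : σ ≤ s.re) (hR : s.re ≤ R) :
    ‖((x + l : ℝ) : ℂ) ^ (-s)‖ ≤ δ ^ (-R) * (1 + l) ^ (-σ) := by
  have hxl : 0 < x + l := by linarith
  rw [Complex.norm_cpow_eq_rpow_re_of_pos hxl, Complex.neg_re]
  calc (x + l) ^ (-s.re) ≤ (δ * (1 + l)) ^ (-s.re) := by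
        refine Real.rpow_le_rpow_of_nonpos (by positivity) ?_ (by linarith)
        nlinarith
    _ = δ ^ (-s.re) * (1 + l) ^ (-s.re) := Real.mul_rpow hδ.le (by linarith)
    _ ≤ δ ^ (-R) * (1 + l) ^ (-σ) := by
        refine mul_le_mul ?_ ?_ (by positivity) (by positivity)
        · exact Real.rpow_le_rpow_of_exponent_ge hδ hδ1 (by linarith)
        · exact Real.rpow_le_rpow_of_exponent_le (by linarith) (by linarith)

namespace HasAbscissa

variable {ι : Type*} {l : ι → ℝ} {c : ℝ}

/-- A summable majorant, valid for `s` near `s₀` and `x` bounded below. -/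
theorem exists_majorant (h : HasAbscissa l c) (hc : 0 ≤ c) {δ : ℝ} (hδ : 0 < δ) {s₀ : ℂ}
    (hs₀ : c < s₀.re) :
    ∃ (V : Set ℂ) (u : ι → ℝ), IsOpen V ∧ s₀ ∈ V ∧ Summable u ∧
      ∀ i, ∀ s ∈ V, ∀ x, δ ≤ x → ‖((x + l i : ℝ) : ℂ) ^ (-s)‖ ≤ u i := by
  obtain ⟨σ, hcσ, hσ⟩ := exists_between hs₀
  refine ⟨{s : ℂ | σ < s.re} ∩ {s : ℂ | s.re < s₀.re + 1},
    fun i => (min δ 1) ^ (-(s₀.re + 1)) * (1 + l i) ^ (-σ),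
    (isOpen_lt continuous_const Complex.continuous_re).inter
      (isOpen_lt Complex.continuous_re continuous_const), ⟨hσ, by simp⟩,
    (h.summable σ hcσ).mul_left _, fun i s hs x hx => ?_⟩
  exact norm_cpow_shift_le (lt_min hδ one_pos) (min_le_right _ _) ((min_le_left _ _).trans hx)
    (h.nonneg i) (hc.trans hcσ.le) (le_of_lt hs.1) (le_of_lt hs.2)

theorem summable_cpow (h : HasAbscissa l c) (hc : 0 ≤ c) {s : ℂ} (hs : c < s.re) {x : ℝ}
    (hx : 0 < x) : Summable fun i => ((x + l i : ℝ) : ℂ) ^ (-s) := by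
  obtain ⟨V, u, -, hsV, hu, hle⟩ := h.exists_majorant hc hx hs
  exact .of_norm_bounded hu fun i => hle i s hsV x le_rfl

theorem continuousOn_shiftedSeries (h : HasAbscissa l c) (hc : 0 ≤ c) :
    ContinuousOn (Function.uncurry (shiftedSeries l)) ({s : ℂ | c < s.re} ×ˢ Ioi 0) := by
  rintro ⟨s₀, x₀⟩ ⟨hs₀, hx₀⟩
  have hx₀ : 0 < x₀ := hx₀
  obtain ⟨V, u, hV, hsV, hu, hle⟩ := h.exists_majorant hc (half_pos hx₀) hs₀
  have hon : ContinuousOn (Function.uncurry (shiftedSeries l)) (V ×ˢ Ioi (x₀ / 2)) := by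
    refine continuousOn_tsum (fun i => ?_) hu fun i p hp => hle i p.1 hp.1 p.2 (le_of_lt hp.2)
    refine continuousOn_ofReal_cpow_neg.comp (f := fun p : ℂ × ℝ => (p.1, p.2 + l i))
      (by fun_prop) fun p hp => ⟨mem_univ _, ?_⟩
    have h1 : x₀ / 2 < p.2 := hp.2
    have h2 := h.nonneg i
    simp only [mem_Ioi]
    linarith
  exact (hon.continuousAt ((hV.prod isOpen_Ioi).mem_nhds
    ⟨hsV, half_lt_self hx₀⟩)).continuousWithinAt

theorem differentiableOn_shiftedSeries (h : HasAbscissa l c) (hc : 0 ≤ c) {x : ℝ} (hx : 0 < x) :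
    DifferentiableOn ℂ (fun s => shiftedSeries l s x) {s : ℂ | c < s.re} := by
  intro s₀ hs₀
  obtain ⟨V, u, hV, hsV, hu, hle⟩ := h.exists_majorant hc hx hs₀
  refine ((Complex.differentiableOn_tsum_of_summable_norm hu (fun i => ?_) hV
    fun i s hs => hle i s hs x le_rfl).differentiableAt (hV.mem_nhds hsV)).differentiableWithinAt
  have : ((x + l i : ℝ) : ℂ) ≠ 0 := by
    have := h.nonneg i
    exact_mod_cast (by linarith : x + l i ≠ 0)
  exact DifferentiableOn.const_cpow (by fun_prop) (Or.inl this)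

theorem hasDerivAt_shiftedSeries (h : HasAbscissa l c) (hc : 0 ≤ c) {s : ℂ} (hs : c < s.re) {x : ℝ}
    (hx : 0 < x) : HasDerivAt (shiftedSeries l s) (-s * shiftedSeries l (s + 1) x) x := by
  have hs1 : c < (s + 1).re := by simp; linarith
  obtain ⟨V, u, -, hsV, hu, hle⟩ := h.exists_majorant hc (half_pos hx) hs1
  have key := hasDerivAt_tsum_of_isPreconnected (t := Ioi (x / 2)) (y₀ := x) (y := x)
    (g := fun i (y : ℝ) => ((y + l i : ℝ) : ℂ) ^ (-s))
    (g' := fun i y => -s * ((y + l i : ℝ) : ℂ) ^ (-(s + 1)))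
    (hu.mul_left ‖-s‖) isOpen_Ioi isPreconnected_Ioi (fun i y hy => ?_) (fun i y hy => ?_)
    (half_lt_self hx) (h.summable_cpow hc hs hx) (half_lt_self hx)
  · rw [tsum_mul_left] at key
    exact key
  · have h1 : 0 < y + l i := by
      have := h.nonneg i
      have : x / 2 < y := hy
      linarith
    have := (hasDerivAt_ofReal_cpow (-s) h1).comp_add_const y (l i)
    rwa [← neg_add'] at this
  · rw [norm_mul]
    exact mul_le_mul_of_nonneg_left (hle i _ hsV y (le_of_lt hy)) (norm_nonneg _)

theorem hasSum_integral_shiftedSeries [Countable ι] (h : HasAbscissa l c) (hc : 0 ≤ c) {s : ℂ}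
    (hs : c < s.re) {x v : ℝ} (hx : 0 < x) (hv : 0 ≤ v) :
    HasSum (fun i => ∫ t in (0 : ℝ)..v, ((x + t + l i : ℝ) : ℂ) ^ (-s))
      (∫ t in (0 : ℝ)..v, shiftedSeries l s (x + t)) := by
  obtain ⟨V, u, -, hsV, hu, hle⟩ := h.exists_majorant hc hx hs
  refine intervalIntegral.hasSum_integral_of_dominated_convergence (fun i _ => u i) (fun i => ?_)
    (fun i => ae_of_all _ fun t ht => ?_) (ae_of_all _ fun t _ => hu) intervalIntegrable_const
    (ae_of_all _ fun t ht => ?_)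
  · refine ContinuousOn.aestronglyMeasurable ?_ measurableSet_uIoc
    refine continuousOn_ofReal_cpow_neg.comp (f := fun t : ℝ => (s, x + t + l i)) (by fun_prop)
      fun t ht => ⟨mem_univ _, ?_⟩
    rw [uIoc_of_le hv] at ht
    have := h.nonneg i
    have := ht.1
    simp only [mem_Ioi]
    linarith
  · rw [uIoc_of_le hv] at ht
    exact hle i s hsV _ (by linarith [ht.1])
  · rw [uIoc_of_le hv] at ht
    exact (h.summable_cpow hc hs (by linarith [ht.1])).hasSum

end HasAbscissa

/-- Integration by parts against the ramp `v - t`. -/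
theorem rampAverage_deriv {f f' : ℝ → ℂ} (hd : ∀ x, 0 < x → HasDerivAt f (f' x) x)
    (hf' : ContinuousOn f' (Ioi 0)) {v : ℝ} (hv : 0 < v) {x : ℝ} (hx : 0 < x) :
    rampAverage v f' x = (v : ℂ)⁻¹ * (∫ t in (0 : ℝ)..v, f (x + t)) - f x := by
  have hpos : ∀ {t}, t ∈ uIcc 0 v → 0 < x + t := fun ht => by
    rw [uIcc_of_le hv.le] at ht; linarith [ht.1]
  have hfc : ContinuousOn f (Ioi 0) := fun y hy => (hd y hy).continuousAt.continuousWithinAt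
  have h1 : IntervalIntegrable (fun t => f (x + t)) volume 0 v :=
    (hfc.comp (f := fun t => x + t) (by fun_prop) fun t ht => hpos ht).intervalIntegrable
  have h2 : IntervalIntegrable (fun t => ((v - t : ℝ) : ℂ) * f' (x + t)) volume 0 v :=
    (ContinuousOn.mul (by fun_prop)
      (hf'.comp (f := fun t => x + t) (by fun_prop) fun t ht => hpos ht)).intervalIntegrable
  have key := intervalIntegral.integral_eq_sub_of_hasDerivAt (a := 0) (b := v)
    (f := fun t : ℝ => ((v - t : ℝ) : ℂ) * f (x + t))
    (f' := fun t => ((v - t : ℝ) : ℂ) * f' (x + t) - f (x + t)) (fun t ht => ?_) (h2.sub h1)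
  · rw [intervalIntegral.integral_sub h2 h1] at key
    have hv' : (v : ℂ) ≠ 0 := by exact_mod_cast hv.ne'
    rw [rampAverage, sub_eq_iff_eq_add.1 key]
    simp only [sub_self, Complex.ofReal_zero, sub_zero, add_zero]
    field_simp
    ring
  · have ha : HasDerivAt (fun t : ℝ => ((v - t : ℝ) : ℂ)) (-1) t := by
      have := ((hasDerivAt_id t).const_sub v).ofReal_comp
      simpa using this
    refine (ha.mul ((hd (x + t) (hpos ht)).comp_const_add x t)).congr_deriv ?_
    ring

theorem rampAverage_const_mul (v : ℝ) (C : ℂ) (f : ℝ → ℂ) (x : ℝ) :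
    rampAverage v (fun y => C * f y) x = C * rampAverage v f x := by
  simp only [rampAverage, mul_left_comm _ C, intervalIntegral.integral_const_mul]

theorem HasAbscissa.shiftedSeries_eq {ι : Type*} {l : ι → ℝ} {c : ℝ} (h : HasAbscissa l c)
    (hc : 0 ≤ c) {s : ℂ} (hs : c < s.re) {x v : ℝ} (hx : 0 < x) (hv : 0 < v) :
    shiftedSeries l s x = (v : ℂ)⁻¹ * (∫ t in (0 : ℝ)..v, shiftedSeries l s (x + t)) +
      s * rampAverage v (shiftedSeries l (s + 1)) x := by
  have hcont : ContinuousOn (shiftedSeries l (s + 1)) (Ioi 0) :=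
    (h.continuousOn_shiftedSeries hc).comp (f := fun x : ℝ => (s + 1, x)) (by fun_prop)
      fun x hx => ⟨by simp; linarith, hx⟩
  have := rampAverage_deriv (fun x hx => h.hasDerivAt_shiftedSeries hc hs hx)
    (continuousOn_const.mul hcont) hv hx
  rw [rampAverage_const_mul] at this
  linear_combination this

theorem hasAbscissa_nat {w : ℝ} (hw : 0 < w) : HasAbscissa (fun n : ℕ => n * w) 1 where
  nonneg n := by positivity
  summable σ hσ := by
    have hκ : 0 < min 1 w := lt_min one_pos hw
    have h1 : Summable fun n : ℕ => ((n : ℝ) + 1) ^ (-σ) := by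
      have := (summable_nat_add_iff 1).2 (Real.summable_nat_rpow.2 (by linarith : -σ < -1))
      simpa using this
    refine .of_nonneg_of_le (fun n => by positivity) (fun n => ?_) (h1.mul_left (min 1 w ^ (-σ)))
    rw [← Real.mul_rpow hκ.le (by positivity)]
    refine Real.rpow_le_rpow_of_nonpos (by positivity) ?_ (by linarith)
    have hn : (0 : ℝ) ≤ n := n.cast_nonneg
    nlinarith [min_le_left 1 w, min_le_right 1 w]

theorem hasAbscissa_nat_prod {v w : ℝ} (hv : 0 < v) (hw : 0 < w) :
    HasAbscissa (fun p : ℕ × ℕ => p.1 * v + p.2 * w) 2 where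
  nonneg p := by positivity
  summable σ hσ := by
    have h1 := ((hasAbscissa_nat hv).summable (σ / 2) (by linarith)).mul_of_nonneg
      ((hasAbscissa_nat hw).summable (σ / 2) (by linarith)) (fun n => by positivity)
      (fun n => by positivity)
    refine .of_nonneg_of_le (fun p => by positivity) (fun p => ?_) h1
    rw [← Real.mul_rpow (by positivity) (by positivity)]
    have h2 : (1 + (p.1 * v + p.2 * w)) ^ (-σ) = ((1 + (p.1 * v + p.2 * w)) ^ 2) ^ (-(σ / 2)) := by
      rw [← Real.rpow_natCast, ← Real.rpow_mul (by positivity)]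
      congr 1
      push_cast
      ring
    rw [h2]
    refine Real.rpow_le_rpow_of_nonpos (by positivity) ?_ (by linarith)
    have ha : 0 ≤ p.1 * v := by positivity
    have hb : 0 ≤ p.2 * w := by positivity
    nlinarith [mul_nonneg ha hb, sq_nonneg (p.1 * v), sq_nonneg (p.2 * w)]

theorem integral_cpow_shift {s : ℂ} (hs : s ≠ 1) {y v : ℝ} (hy : 0 < y) (hv : 0 ≤ v) :
    ∫ t in (0 : ℝ)..v, ((y + t : ℝ) : ℂ) ^ (-s) =
      ((y : ℂ) ^ (1 - s) - ((y + v : ℝ) : ℂ) ^ (1 - s)) / (s - 1) := by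
  have hs' : s - 1 ≠ 0 := sub_ne_zero.2 hs
  have hpos : ∀ {t}, t ∈ uIcc 0 v → 0 < y + t := fun ht => by
    rw [uIcc_of_le hv] at ht; linarith [ht.1]
  rw [intervalIntegral.integral_eq_sub_of_hasDerivAt
    (f := fun t : ℝ => -(((y + t : ℝ) : ℂ) ^ (1 - s) / (s - 1))) (fun t ht => ?_) ?_]
  · simp only [add_zero]
    ring
  · refine ContinuousOn.intervalIntegrable ?_
    exact continuousOn_ofReal_cpow_neg.comp (f := fun t : ℝ => (s, y + t)) (by fun_prop)
      fun t ht => ⟨mem_univ _, hpos ht⟩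
  · have := (((hasDerivAt_ofReal_cpow (1 - s) (hpos ht)).comp_const_add y t).div_const
      (s - 1)).neg
    refine this.congr_deriv ?_
    rw [show 1 - s - 1 = -s by ring]
    field_simp
    ring

/-- The intervals `[x + n w, x + (n + 1) w]` tile `[x, ∞)`. -/
theorem hasSum_integral_cpow {s : ℂ} (hs : 1 < s.re) {x w : ℝ} (hx : 0 < x) (hw : 0 < w) :
    HasSum (fun n : ℕ => ∫ t in (0 : ℝ)..w, ((x + t + n * w : ℝ) : ℂ) ^ (-s))
      ((x : ℂ) ^ (1 - s) / (s - 1)) := by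
  have hs1 : s ≠ 1 := by rintro rfl; simp at hs
  have h := (hasAbscissa_nat hw).hasSum_integral_shiftedSeries zero_le_one hs hx hw.le
  have hterm : ∀ n : ℕ, ∫ t in (0 : ℝ)..w, ((x + t + n * w : ℝ) : ℂ) ^ (-s) =
      ((x + n * w : ℝ) : ℂ) ^ (1 - s) / (s - 1) -
        ((x + (n + 1 : ℕ) * w : ℝ) : ℂ) ^ (1 - s) / (s - 1) := fun n => by
    rw [← sub_div, show x + (n + 1 : ℕ) * w = x + n * w + w by push_cast; ring,
      ← integral_cpow_shift hs1 (by positivity) hw.le]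
    refine intervalIntegral.integral_congr fun t _ => ?_
    simp only [add_right_comm x t]
  have hlim : Tendsto (fun n : ℕ => ((x + n * w : ℝ) : ℂ) ^ (1 - s) / (s - 1)) atTop (𝓝 0) := by
    rw [← zero_div (s - 1)]
    refine Tendsto.div_const (tendsto_zero_iff_norm_tendsto_zero.2 ?_) _
    have h1 : Tendsto (fun n : ℕ => x + n * w) atTop atTop :=
      tendsto_atTop_add_const_left _ _ (tendsto_natCast_atTop_atTop.atTop_mul_const hw)
    have h2 := (tendsto_rpow_neg_atTop (by linarith : 0 < s.re - 1)).comp h1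
    refine h2.congr fun n => ?_
    rw [Complex.norm_cpow_eq_rpow_re_of_pos (by positivity)]
    simp
  have hpart := h.tendsto_sum_nat
  simp only [hterm, Finset.sum_range_sub'] at hpart
  have := tendsto_nhds_unique hpart (tendsto_const_nhds.sub hlim)
  rw [this] at h
  simpa using h

theorem integral_shiftedSeries_prod {s : ℂ} (hs : 2 < s.re) {x v w : ℝ} (hx : 0 < x) (hv : 0 < v)
    (hw : 0 < w) :
    ∫ t in (0 : ℝ)..w, shiftedSeries (fun p : ℕ × ℕ => p.1 * v + p.2 * w) s (x + t) =
      shiftedSeries (fun n : ℕ => n * v) (s - 1) x / (s - 1) := by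
  have h := (hasAbscissa_nat_prod hv hw).hasSum_integral_shiftedSeries zero_le_two hs hx hw.le
  have h1 := h.prod_fiberwise fun m => by
    have := hasSum_integral_cpow (by linarith) (by positivity : 0 < x + m * v) hw (s := s)
    refine this.congr_fun fun n => intervalIntegral.integral_congr fun t _ => ?_
    simp only
    congr 2
    ring
  rw [← h1.tsum_eq, tsum_div_const]
  simp [shiftedSeries]

theorem isLadder_cpow (C : ℂ) : IsLadder 1 univ (fun s x => C * (x : ℂ) ^ (1 - s)) where
  continuousOn := by
    refine continuousOn_const.mul ?_
    refine (continuousOn_ofReal_cpow_neg.comp (f := fun p : ℂ × ℝ => (p.1 - 1, p.2))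
      (s := univ ×ˢ Ioi 0) (by fun_prop) fun p hp => ⟨mem_univ _, hp.2⟩).congr fun p _ => ?_
    simp
  differentiableOn x hx := by
    have : (x : ℂ) ≠ 0 := by exact_mod_cast hx.ne'
    exact (DifferentiableOn.const_cpow (by fun_prop) (Or.inl this)).const_mul _
  hasDerivAt s _ x hx := by
    refine ((hasDerivAt_ofReal_cpow (1 - s) hx).const_mul C).congr_deriv ?_
    rw [show 1 - s - 1 = 1 - (s + 1) by ring]
    ring

/-- `(s - 1) ∑ₙ (x + n w)^{-s}` extends to an entire ladder. -/
theorem exists_hurwitz_ladder {w : ℝ} (hw : 0 < w) :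
    ∃ H : ℂ → ℝ → ℂ, IsLadder 1 univ H ∧
      (∀ s : ℂ, 1 < s.re → ∀ x, 0 < x →
        H s x = (s - 1) * shiftedSeries (fun n : ℕ => n * w) s x) ∧
      (∀ x, 0 < x → H 1 x = (w : ℂ)⁻¹) ∧ ∀ x : ℝ, 0 < x → H 0 x = x / w - 1 / 2 := by
  have hA := hasAbscissa_nat hw
  have hw' : (w : ℂ) ≠ 0 := by exact_mod_cast hw.ne'
  have hF : IsLadder 1 {s : ℂ | 1 < s.re}
      (fun s x => (s - 1) * shiftedSeries (fun n : ℕ => n * w) s x) := by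
    refine ⟨?_, fun x hx => ?_, fun s hs x hx => ?_⟩
    · exact ContinuousOn.mul (by fun_prop) (hA.continuousOn_shiftedSeries zero_le_one)
    · exact DifferentiableOn.mul (by fun_prop) (hA.differentiableOn_shiftedSeries zero_le_one hx)
    · refine ((hA.hasDerivAt_shiftedSeries zero_le_one hs hx).const_mul (s - 1)).congr_deriv ?_
      ring
  obtain ⟨H, hH, hHF, hrec⟩ := (isLadder_cpow (w : ℂ)⁻¹).exists_extension hF hw
    fun s hs x hx => by
      have hs1 : s - 1 ≠ 0 := sub_ne_zero.2 (by rintro rfl; simp at hs)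
      have h1 := (hA.hasSum_integral_shiftedSeries zero_le_one hs hx hw.le).unique
        (hasSum_integral_cpow hs hx hw)
      rw [hA.shiftedSeries_eq zero_le_one hs hx hw, h1, rampAverage_const_mul]
      generalize rampAverage _ _ _ = A
      field_simp
      ring
  have hH1 : ∀ x, 0 < x → H 1 x = (w : ℂ)⁻¹ := fun x hx => by
    rw [hrec 1 x hx]
    simp
  refine ⟨H, hH, hHF, hH1, fun x hx => ?_⟩
  rw [hrec 0 x hx, zero_add, rampAverage_congr hw (g := fun _ => (w : ℂ)⁻¹)
    (fun y hy => hH1 y hy) hx, rampAverage_const hw]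
  simp only [sub_zero, Complex.cpow_one]
  field_simp
  ring

/-- `(s - 1) (s - 2) ∑ (x + m v + n w)^{-s}` extends to an entire ladder. -/
theorem exists_barnes_ladder {v w : ℝ} (hv : 0 < v) (hw : 0 < w) :
    ∃ G : ℂ → ℝ → ℂ, IsLadder 2 univ G ∧
      (∀ s : ℂ, 2 < s.re → ∀ x, 0 < x →
        G s x = (s - 1) * (s - 2) *
          shiftedSeries (fun p : ℕ × ℕ => p.1 * v + p.2 * w) s x) ∧
      ∀ x : ℝ, 0 < x → G 1 x = (2 * x - v - w) / (2 * v * w) := by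
  have hA := hasAbscissa_nat_prod hv hw
  have hw' : (w : ℂ) ≠ 0 := by exact_mod_cast hw.ne'
  have hv' : (v : ℂ) ≠ 0 := by exact_mod_cast hv.ne'
  obtain ⟨H, hH, hHF, hH1, hH0⟩ := exists_hurwitz_ladder hv
  have hE : IsLadder 2 univ (fun s x => (w : ℂ)⁻¹ * H (s - 1) x) := by
    refine ⟨?_, fun x hx => ?_, fun s _ x hx => ?_⟩
    · exact continuousOn_const.mul (hH.continuousOn.comp (f := fun p : ℂ × ℝ => (p.1 - 1, p.2))
        (by fun_prop) fun p hp => ⟨mem_univ _, hp.2⟩)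
    · exact ((hH.differentiableOn x hx).comp (f := fun s : ℂ => s - 1) (by fun_prop)
        fun s _ => mem_univ _).const_mul _
    · refine ((hH.hasDerivAt (s - 1) (mem_univ _) x hx).const_mul (w : ℂ)⁻¹).congr_deriv ?_
      rw [sub_add_cancel, add_sub_cancel_right]
      ring
  have hF : IsLadder 2 {s : ℂ | 2 < s.re}
      (fun s x => (s - 1) * (s - 2) *
        shiftedSeries (fun p : ℕ × ℕ => p.1 * v + p.2 * w) s x) := by
    refine ⟨?_, fun x hx => ?_, fun s hs x hx => ?_⟩
    · exact ContinuousOn.mul (by fun_prop) (hA.continuousOn_shiftedSeries zero_le_two)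
    · exact DifferentiableOn.mul (by fun_prop) (hA.differentiableOn_shiftedSeries zero_le_two hx)
    · refine ((hA.hasDerivAt_shiftedSeries zero_le_two hs hx).const_mul
        ((s - 1) * (s - 2))).congr_deriv ?_
      ring
  obtain ⟨G, hG, hGF, hrec⟩ := hE.exists_extension hF hw fun s hs x hx => by
    have hs1 : s - 1 ≠ 0 := sub_ne_zero.2 (by rintro rfl; norm_num at hs)
    rw [hA.shiftedSeries_eq zero_le_two hs hx hw, integral_shiftedSeries_prod hs hx hv hw,
      rampAverage_const_mul, hHF (s - 1) (by simp; linarith) x hx]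
    generalize rampAverage _ _ _ = A
    generalize shiftedSeries _ _ _ = B
    field_simp
    ring
  have hG2 : ∀ x, 0 < x → G 2 x = (w : ℂ)⁻¹ * (v : ℂ)⁻¹ := fun x hx => by
    rw [hrec 2 x hx, show (2 : ℂ) - 1 = 1 by norm_num, hH1 x hx]
    simp
  refine ⟨G, hG, hGF, fun x hx => ?_⟩
  rw [hrec 1 x hx, sub_self, hH0 x hx, show (1 : ℂ) + 1 = 2 by norm_num,
    rampAverage_congr hw (g := fun _ => (w : ℂ)⁻¹ * (v : ℂ)⁻¹) (fun y hy => hG2 y hy) hx,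
    rampAverage_const hw]
  field_simp
  ring

theorem circleIntegral_add_center (f : ℂ → ℂ) (c a : ℂ) (R : ℝ) :
    (∮ s in C(c + a, R), f s) = ∮ s in C(c, R), f (s + a) := by
  simp only [circleIntegral, deriv_circleMap, circleMap]
  refine intervalIntegral.integral_congr fun θ _ => ?_
  congr 2
  ring

namespace IsLadder

variable {e : ℂ} {G : ℂ → ℝ → ℂ}

/-- Contour integrals of a ladder against a continuous weight are differentiable in `x`, and the
derivative has the same shape. -/
theorem hasDerivAt_circleIntegral (hG : IsLadder e univ G) {c : ℂ} {R : ℝ} (hR : 0 ≤ R) {q : ℂ → ℂ}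
    (hq : ContinuousOn q (Metric.sphere c R)) {x : ℝ} (hx : 0 < x) :
    HasDerivAt (fun y => ∮ s in C(c, R), q s * G s y)
      (∮ s in C(c + 1, R), q (s - 1) * (e + 1 - s) * G s x) x := by
  rw [circleIntegral_add_center]
  have hm : ∀ θ, circleMap c R θ ∈ Metric.sphere c R := circleMap_mem_sphere c hR
  have hcm : Continuous (circleMap c R) := continuous_circleMap c R
  have hqc : Continuous fun θ => q (circleMap c R θ) := hq.comp_continuous hcm hm
  simp only [circleIntegral, smul_eq_mul, deriv_circleMap]
  refine hasDerivAt_intervalIntegral_of_continuousOn (𝕜 := ℝ) isOpen_Ioi Real.two_pi_pos.le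
    (f' := fun y θ => circleMap 0 R θ * Complex.I * (q (circleMap c R θ + 1 - 1) *
      (e + 1 - (circleMap c R θ + 1)) * G (circleMap c R θ + 1) y)) ?_ ?_ ?_ (mem_Ioi.2 hx)
  · intro y hy
    refine ContinuousOn.mul (by fun_prop) (hqc.continuousOn.mul ?_)
    exact hG.continuousOn.comp (f := fun θ : ℝ => (circleMap c R θ, y)) (by fun_prop)
      fun θ _ => ⟨mem_univ _, hy⟩
  · simp only [add_sub_cancel_right]
    refine ContinuousOn.mul (by fun_prop) (ContinuousOn.mul
      ((hqc.comp continuous_snd).continuousOn.mul (by fun_prop)) ?_)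
    exact hG.continuousOn.comp (f := fun p : ℝ × ℝ => (circleMap c R p.2 + 1, p.1)) (by fun_prop)
      fun p hp => ⟨mem_univ _, hp.1⟩
  · intro y hy θ _
    have h := ((hG.hasDerivAt (circleMap c R θ) (mem_univ _) y hy).const_mul
      (q (circleMap c R θ))).const_mul (circleMap 0 R θ * Complex.I)
    refine h.congr_deriv ?_
    rw [add_sub_cancel_right]
    ring

theorem differentiableAt_iteratedDeriv_circleIntegral (hG : IsLadder e univ G) {R : ℝ} (hR : 0 ≤ R)
    (k : ℕ) {c : ℂ} {q : ℂ → ℂ} (hq : ContinuousOn q (Metric.sphere c R)) {x : ℝ} (hx : 0 < x) :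
    DifferentiableAt ℝ (iteratedDeriv k fun y => ∮ s in C(c, R), q s * G s y) x := by
  induction k generalizing c q with
  | zero =>
    rw [iteratedDeriv_zero]
    exact (hG.hasDerivAt_circleIntegral hR hq hx).differentiableAt
  | succ k ih =>
    rw [iteratedDeriv_succ']
    have hq' : ContinuousOn (fun s => q (s - 1) * (e + 1 - s)) (Metric.sphere (c + 1) R) := by
      refine ContinuousOn.mul (hq.comp (f := fun s => s - 1) (by fun_prop) fun s hs => ?_)
        (by fun_prop)
      simp only [mem_sphere_iff_norm] at hs ⊢
      rw [← hs]
      congr 1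
      ring
    have hev : (deriv fun y => ∮ s in C(c, R), q s * G s y) =ᶠ[𝓝 x]
        fun y => ∮ s in C(c + 1, R), q (s - 1) * (e + 1 - s) * G s y := by
      filter_upwards [Ioi_mem_nhds hx] with y hy
      exact (hG.hasDerivAt_circleIntegral hR hq hy).deriv
    exact (ih hq').congr_of_eventuallyEq (hev.iteratedDeriv k)

end IsLadder

/-- Taylor coefficients as contour integrals. -/
theorem contour_coefficient_eq {g : ℂ → ℂ} {c : ℂ} (hg : DifferentiableOn ℂ g (Metric.ball c 1))
    (n : ℕ) : (2 * Real.pi * Complex.I)⁻¹ * ∮ s in C(c, 1 / 2), g s / (s - c) ^ (n + 1) =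
      (n.factorial : ℂ)⁻¹ * iteratedDeriv n g c := by
  have h := DifferentiableOn.circleIntegral_one_div_sub_center_pow_smul (c := c) (R := 1 / 2)
    (f := g) (by norm_num) n (hg.mono (Metric.closedBall_subset_ball (by norm_num)))
  have h2 : (∮ s in C(c, 1 / 2), g s / (s - c) ^ (n + 1)) =
      ∮ s in C(c, 1 / 2), (1 / (s - c) ^ (n + 1)) • g s := by
    congr 1
    ext s
    rw [smul_eq_mul]
    ring
  rw [h2, h, smul_eq_mul, div_eq_mul_inv, mul_assoc (2 * (Real.pi : ℂ) * Complex.I),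
    inv_mul_cancel_left₀ Complex.two_pi_I_ne_zero]

theorem IsBarnesContinuation.eqOn {α v w : ℝ} {Z Z' : ℂ → ℂ} (h : IsBarnesContinuation α v w Z)
    (h' : IsBarnesContinuation α v w Z') : EqOn Z Z' {1, 2}ᶜ := by
  have hfin : ({1, 2} : Set ℂ).Finite := by simp
  have hopen : IsOpen ({1, 2}ᶜ : Set ℂ) := hfin.isClosed.isOpen_compl
  have hconn : IsPreconnected ({1, 2}ᶜ : Set ℂ) :=
    (hfin.countable.isConnected_compl_of_one_lt_rank (by simp)).isPreconnected
  refine (h.1.analyticOnNhd hopen).eqOn_of_preconnected_of_eventuallyEq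
    (h'.1.analyticOnNhd hopen) hconn (z₀ := 3) (by norm_num) ?_
  filter_upwards [(IsLadder.isOpen_re_gt 2).mem_nhds (by norm_num : (2 : ℝ) < (3 : ℂ).re)] with s hs
  exact (h.2 s hs).unique (h'.2 s hs)

theorem isBarnesContinuation_barnesZeta {α v w : ℝ} {Z : ℂ → ℂ}
    (h : IsBarnesContinuation α v w Z) :
    IsBarnesContinuation α v w (fun s => barnesZeta s α v w) := by
  have hex : ∃ Z : ℂ → ℂ, IsBarnesContinuation α v w Z := ⟨Z, h⟩
  have : (fun s => barnesZeta s α v w) = hex.choose := by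
    ext s
    rw [barnesZeta, dif_pos hex]
  rw [this]
  exact hex.choose_spec

theorem IsBarnesContinuation.conj {α v w : ℝ} (hα : 0 < α) (hv : 0 < v) (hw : 0 < w) {Z : ℂ → ℂ}
    (h : IsBarnesContinuation α v w Z) :
    IsBarnesContinuation α v w (starRingEnd ℂ ∘ Z ∘ starRingEnd ℂ) := by
  have hopen : IsOpen ({1, 2}ᶜ : Set ℂ) := (by simp : ({1, 2} : Set ℂ).Finite).isClosed.isOpen_compl
  refine ⟨fun s hs => ?_, fun s hs => ?_⟩
  · have hs' : (starRingEnd ℂ) s ∈ ({1, 2}ᶜ : Set ℂ) := by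
      simp only [mem_compl_iff, mem_insert_iff, mem_singleton_iff, not_or] at hs ⊢
      refine ⟨fun h1 => hs.1 ?_, fun h1 => hs.2 ?_⟩
      · simpa using congrArg (starRingEnd ℂ) h1
      · simpa [Complex.conj_ofNat] using congrArg (starRingEnd ℂ) h1
    have := (h.1.differentiableAt (hopen.mem_nhds hs')).conj_conj
    simpa using this.differentiableWithinAt
  · have h1 := (h.2 ((starRingEnd ℂ) s) (by simpa using hs)).map (starRingEnd ℂ)
      Complex.continuous_conj
    refine h1.congr_fun fun p => ?_
    have hp : 0 ≤ α + p.1 * v + p.2 * w := by positivity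
    have harg : (((α + p.1 * v + p.2 * w : ℝ) : ℂ)).arg ≠ Real.pi := by
      rw [Complex.arg_ofReal_of_nonneg hp]
      exact Real.pi_pos.ne
    simp only [Function.comp_apply, map_div₀, map_one]
    rw [Complex.cpow_conj _ _ harg, Complex.conj_ofReal, Complex.conj_conj]

theorem log_doubleGamma {α v w : ℝ} (hα : 0 < α) (hv : 0 < v) (hw : 0 < w)
    (h : IsBarnesContinuation α v w (fun s => barnesZeta s α v w)) :
    Complex.log (doubleGamma α v w) = logDoubleGamma α v w := by
  have hopen : IsOpen ({1, 2}ᶜ : Set ℂ) := (by simp : ({1, 2} : Set ℂ).Finite).isClosed.isOpen_compl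
  have hev := ((h.conj hα hv hw).eqOn h).eventuallyEq_of_mem
    (hopen.mem_nhds (by norm_num : (0 : ℂ) ∈ ({1, 2}ᶜ : Set ℂ)))
  have hd := hev.deriv_eq
  have h0 : (logDoubleGamma α v w).im = 0 := by
    rw [← Complex.conj_eq_iff_im, logDoubleGamma]
    rw [deriv_conj_conj] at hd
    simpa using hd
  rw [doubleGamma, Complex.log_exp] <;> rw [h0] <;> linarith [Real.pi_pos]

theorem circleIntegral_neg (f : ℂ → ℂ) (c : ℂ) (R : ℝ) :
    (∮ s in C(c, R), -f s) = -∮ s in C(c, R), f s := by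
  simp [circleIntegral]

theorem exists_barnesZeta_ladder {v w : ℝ} (hv : 0 < v) (hw : 0 < w) :
    ∃ G : ℂ → ℝ → ℂ, IsLadder 2 univ G ∧
      (∀ x : ℝ, 0 < x → IsBarnesContinuation x v w (fun s => barnesZeta s x v w)) ∧
      (∀ x : ℝ, 0 < x → ∀ s : ℂ, s ≠ 1 → s ≠ 2 →
        barnesZeta s x v w = G s x / ((s - 1) * (s - 2))) ∧
      ∀ x : ℝ, 0 < x → G 1 x = (2 * x - v - w) / (2 * v * w) := by
  obtain ⟨G, hG, hGF, hG1⟩ := exists_barnes_ladder hv hw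
  have hcont : ∀ x : ℝ, 0 < x →
      IsBarnesContinuation x v w (fun s => G s x / ((s - 1) * (s - 2))) := by
    refine fun x hx => ⟨?_, fun s hs => ?_⟩
    · refine ((hG.differentiableOn x hx).mono (subset_univ _)).div (by fun_prop) fun s hs => ?_
      simp only [mem_compl_iff, mem_insert_iff, mem_singleton_iff, not_or] at hs
      exact mul_ne_zero (sub_ne_zero.2 hs.1) (sub_ne_zero.2 hs.2)
    · have h1 : s - 1 ≠ 0 := sub_ne_zero.2 (by rintro rfl; norm_num at hs)
      have h2 : s - 2 ≠ 0 := sub_ne_zero.2 (by rintro rfl; norm_num at hs)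
      simp only
      rw [hGF s hs x hx, mul_div_cancel_left₀ _ (mul_ne_zero h1 h2)]
      refine ((hasAbscissa_nat_prod hv hw).summable_cpow zero_le_two hs hx).hasSum.congr_fun
        fun p => ?_
      rw [Complex.cpow_neg, one_div, add_assoc]
  refine ⟨G, hG, fun x hx => isBarnesContinuation_barnesZeta (hcont x hx), fun x hx s h1 h2 => ?_,
    hG1⟩
  exact (isBarnesContinuation_barnesZeta (hcont x hx)).eqOn (hcont x hx) (by simp [h1, h2])

/-- The weight expressing the contour integrals of `ζ₂(s) (s - c)^{-k}` through
`(s - 1) (s - 2) ζ₂(s)`. -/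
noncomputable def contourWeight (c : ℂ) (k : ℤ) (s : ℂ) : ℂ :=
  ((s - 1) * (s - 2) * (s - c) ^ k)⁻¹

theorem ne_of_mem_sphere_half {c z s : ℂ} (hs : s ∈ Metric.sphere c (1 / 2))
    (hz : ‖z - c‖ ≠ 1 / 2) : s ≠ z := by
  rintro rfl
  exact hz (mem_sphere_iff_norm.1 hs)

theorem continuousOn_contourWeight {c : ℂ} (h1 : ‖1 - c‖ ≠ 1 / 2) (h2 : ‖2 - c‖ ≠ 1 / 2) (k : ℤ) :
    ContinuousOn (contourWeight c k) (Metric.sphere c (1 / 2)) := by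
  have hc : ∀ s ∈ Metric.sphere c (1 / 2), s - c ≠ 0 := fun s hs =>
    sub_ne_zero.2 (ne_of_mem_sphere_half hs (by norm_num))
  refine ContinuousOn.inv₀ (ContinuousOn.mul (by fun_prop)
    (ContinuousOn.zpow₀ (by fun_prop) k fun s hs => Or.inl (hc s hs))) fun s hs => ?_
  exact mul_ne_zero (mul_ne_zero (sub_ne_zero.2 (ne_of_mem_sphere_half hs h1))
    (sub_ne_zero.2 (ne_of_mem_sphere_half hs h2))) (zpow_ne_zero k (hc s hs))

theorem circleIntegral_eq_contourWeight {Z g : ℂ → ℂ}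
    (hZ : ∀ s, s ≠ 1 → s ≠ 2 → Z s = g s / ((s - 1) * (s - 2))) {c : ℂ} (h1 : ‖1 - c‖ ≠ 1 / 2)
    (h2 : ‖2 - c‖ ≠ 1 / 2) (k : ℤ) :
    (∮ s in C(c, 1 / 2), Z s / (s - c) ^ k) =
      ∮ s in C(c, 1 / 2), contourWeight c k s * g s := by
  refine circleIntegral.integral_congr (by norm_num) fun s hs => ?_
  simp only [hZ s (ne_of_mem_sphere_half hs h1) (ne_of_mem_sphere_half hs h2), contourWeight]
  rw [div_div, div_eq_inv_mul]

/-- The Laurent expansion at a simple pole, with contour integrals as coefficients. -/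
theorem hasSum_laurent {Z g : ℂ → ℂ} {c : ℂ} (hg : DifferentiableOn ℂ g (Metric.ball c 1))
    (hZ : ∀ s, 0 < ‖s - c‖ → ‖s - c‖ < 1 → Z s = g s / (s - c)) {s : ℂ} (hs0 : 0 < ‖s - c‖)
    (hs1 : ‖s - c‖ < 1) :
    HasSum (fun n : ℕ => ((2 * Real.pi * Complex.I)⁻¹ *
      ∮ z in C(c, 1 / 2), Z z / (z - c) ^ ((n : ℤ) - 1 + 1)) * (s - c) ^ ((n : ℤ) - 1)) (Z s) := by
  have hsc : s - c ≠ 0 := norm_pos_iff.1 hs0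
  have h := (Complex.hasSum_taylorSeries_on_ball hg (mem_ball_iff_norm.2 hs1)).div_const (s - c)
  rw [← hZ s hs0 hs1] at h
  refine h.congr_fun fun n => ?_
  have hint : (∮ z in C(c, 1 / 2), Z z / (z - c) ^ ((n : ℤ) - 1 + 1)) =
      ∮ z in C(c, 1 / 2), g z / (z - c) ^ (n + 1) := by
    refine circleIntegral.integral_congr (by norm_num) fun z hz => ?_
    rw [mem_sphere_iff_norm] at hz
    simp only [hZ z (by rw [hz]; norm_num) (by rw [hz]; norm_num)]
    rw [sub_add_cancel, zpow_natCast, div_div, pow_succ']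
  rw [hint, contour_coefficient_eq hg, zpow_sub₀ hsc, zpow_natCast, zpow_one]
  simp only [smul_eq_mul]
  ring

theorem theorem2 (α v w : ℝ) (hα : 0 < α) (hv : 0 < v) (hw : 0 < w) :
    -- `ζ₂` is the analytic continuation of the double series
    IsBarnesContinuation α v w (fun s => barnesZeta s α v w) ∧
    -- the Laurent expansions at `s = 1` and `s = 2`
    (∀ s : ℂ, 0 < ‖s - 1‖ → ‖s - 1‖ < 1 →
      HasSum (fun n : ℕ => barnesGamma ((n : ℤ) - 1) 1 α v w * (s - 1) ^ ((n : ℤ) - 1))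
        (barnesZeta s α v w)) ∧
    (∀ s : ℂ, 0 < ‖s - 2‖ → ‖s - 2‖ < 1 →
      HasSum (fun n : ℕ => barnesGamma ((n : ℤ) - 1) 2 α v w * (s - 2) ^ ((n : ℤ) - 1))
        (barnesZeta s α v w)) ∧
    -- the coefficients at `s = 1` from those at `s = 0`
    (∀ k : ℕ,
      DifferentiableAt ℝ (fun a : ℝ => barnesZetaDerivZero k a v w) α ∧
      barnesGamma ((k : ℤ) - 1) 1 α v w
        = -(1 / (k.factorial : ℂ)) * deriv (fun a : ℝ => barnesZetaDerivZero k a v w) α) ∧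
    barnesGamma (-1) 1 α v w = (((v + w - 2 * α) / (2 * v * w) : ℝ) : ℂ) ∧
    -- the double gamma and polygamma functions
    Complex.log (doubleGamma α v w) = logDoubleGamma α v w ∧
    (DifferentiableAt ℝ (fun a : ℝ => logDoubleGamma a v w) α ∧
      barnesGamma 0 1 α v w = -deriv (fun a : ℝ => logDoubleGamma a v w) α) ∧
    (∀ k : ℕ,
      DifferentiableAt ℝ (fun a : ℝ => doublePolygamma k a v w) α ∧
      iteratedDeriv k (fun a : ℝ => barnesGamma 0 1 a v w) α
        = -deriv (fun a : ℝ => doublePolygamma k a v w) α) ∧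
    -- the coefficients at `s = 2` from those at `s = 1`
    (∀ k : ℤ, -1 ≤ k →
      DifferentiableAt ℝ (fun a : ℝ => barnesGamma k 1 a v w) α ∧
      ∑ l ∈ Finset.Icc (-1) k,
          (-1 : ℂ) ^ (k - l + 1) * deriv (fun a : ℝ => barnesGamma l 1 a v w) α
        = barnesGamma k 2 α v w) := by
  obtain ⟨G, hG, hcont, hZ, hG1⟩ := exists_barnesZeta_ladder hv hw
  have hGd : ∀ x, 0 < x → Differentiable ℂ fun s => G s x := fun x hx =>
    differentiableOn_univ.1 (hG.differentiableOn x hx)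
  have n01 : ‖(1 : ℂ) - 0‖ ≠ 1 / 2 := by norm_num
  have n02 : ‖(2 : ℂ) - 0‖ ≠ 1 / 2 := by norm_num
  have n11 : ‖(1 : ℂ) - 1‖ ≠ 1 / 2 := by norm_num
  have n12 : ‖(2 : ℂ) - 1‖ ≠ 1 / 2 := by norm_num
  have n21 : ‖(1 : ℂ) - 2‖ ≠ 1 / 2 := by norm_num
  have n22 : ‖(2 : ℂ) - 2‖ ≠ 1 / 2 := by norm_num
  have n31 : ‖(3 : ℂ) - 1‖ ≠ 1 / 2 := by norm_num
  have n32 : ‖(3 : ℂ) - 2‖ ≠ 1 / 2 := by norm_num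
  have hhalf : (0 : ℝ) ≤ 1 / 2 := by norm_num
  have hγ1 : ∀ (k : ℤ) (x : ℝ), 0 < x → barnesGamma k 1 x v w = (2 * Real.pi * Complex.I)⁻¹ *
      ∮ s in C(1, 1 / 2), contourWeight 1 (k + 1) s * G s x := fun k x hx => by
    rw [barnesGamma, circleIntegral_eq_contourWeight (hZ x hx) n11 n12]
  have hγ2 : ∀ (k : ℤ) (x : ℝ), 0 < x → barnesGamma k 2 x v w = (2 * Real.pi * Complex.I)⁻¹ *
      ∮ s in C(2, 1 / 2), contourWeight 2 (k + 1) s * G s x := fun k x hx => by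
    rw [barnesGamma, circleIntegral_eq_contourWeight (hZ x hx) n21 n22]
  have hζ0 : ∀ (k : ℕ) (x : ℝ), 0 < x → barnesZetaDerivZero k x v w = k.factorial *
      ((2 * Real.pi * Complex.I)⁻¹ *
        ∮ s in C(0, 1 / 2), contourWeight 0 ((k + 1 : ℕ) : ℤ) s * G s x) := fun k x hx => by
    have hd : DifferentiableOn ℂ (fun s => barnesZeta s x v w) (Metric.ball 0 1) := by
      refine (hcont x hx).1.mono fun s hs => ?_
      rw [mem_ball_zero_iff] at hs
      simp only [mem_compl_iff, mem_insert_iff, mem_singleton_iff, not_or]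
      constructor <;> rintro rfl <;> norm_num at hs
    have h1 := contour_coefficient_eq hd k
    have h2 := circleIntegral_eq_contourWeight (hZ x hx) n01 n02 ((k + 1 : ℕ) : ℤ)
    simp only [zpow_natCast] at h2
    rw [← h2, h1, mul_inv_cancel_left₀ (by exact_mod_cast k.factorial_ne_zero),
      barnesZetaDerivZero]
  have hζ0' : ∀ (k : ℕ) (x : ℝ), 0 < x → HasDerivAt (fun a => barnesZetaDerivZero k a v w)
      (-(k.factorial * barnesGamma ((k : ℤ) - 1) 1 x v w)) x := fun k x hx => by
    have h := ((hG.hasDerivAt_circleIntegral hhalf (continuousOn_contourWeight n01 n02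
      ((k + 1 : ℕ) : ℤ)) hx).const_mul (2 * Real.pi * Complex.I)⁻¹).const_mul (k.factorial : ℂ)
    refine (h.congr_of_eventuallyEq ?_).congr_deriv ?_
    · filter_upwards [Ioi_mem_nhds hx] with y hy using hζ0 k y hy
    · rw [hγ1 _ x hx, ← mul_neg, ← mul_neg, ← circleIntegral_neg, zero_add]
      congr 2
      refine circleIntegral.integral_congr hhalf fun s hs => ?_
      have h1 := sub_ne_zero.2 (ne_of_mem_sphere_half hs n11)
      have h2 := sub_ne_zero.2 (ne_of_mem_sphere_half hs n12)
      have h3 := sub_ne_zero.2 (ne_of_mem_sphere_half hs n31)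
      simp only [contourWeight, sub_add_cancel, zpow_natCast, sub_zero]
      rw [show s - 1 - 1 = s - 2 by ring, show s - 1 - 2 = s - 3 by ring, pow_succ]
      field_simp
      ring
  have hγ1' : ∀ k : ℤ, HasDerivAt (fun a => barnesGamma k 1 a v w)
      (-(barnesGamma k 2 α v w + barnesGamma (k - 1) 2 α v w)) α := fun k => by
    have h := (hG.hasDerivAt_circleIntegral hhalf (continuousOn_contourWeight n11 n12
      (k + 1)) hα).const_mul (2 * Real.pi * Complex.I)⁻¹
    refine (h.congr_of_eventuallyEq ?_).congr_deriv ?_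
    · filter_upwards [Ioi_mem_nhds hα] with y hy using hγ1 k y hy
    · have hint : ∀ j : ℤ, CircleIntegrable (fun s => contourWeight 2 j s * G s α) 2 (1 / 2) :=
        fun j => ((continuousOn_contourWeight n21 n22 j).mul
          (hGd α hα).continuous.continuousOn).circleIntegrable hhalf
      rw [hγ2 _ α hα, hγ2 _ α hα, ← mul_add, ← circleIntegral.integral_add (hint _) (hint _),
        ← mul_neg, ← circleIntegral_neg, show (1 : ℂ) + 1 = 2 by norm_num]
      congr 1
      refine circleIntegral.integral_congr hhalf fun s hs => ?_
      have h1 := sub_ne_zero.2 (ne_of_mem_sphere_half hs n21)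
      have h2 := sub_ne_zero.2 (ne_of_mem_sphere_half hs n22)
      have h3 := sub_ne_zero.2 (ne_of_mem_sphere_half hs n32)
      simp only [contourWeight, sub_add_cancel]
      rw [show s - 1 - 1 = s - 2 by ring, show s - 1 - 2 = s - 3 by ring, zpow_add_one₀ h2]
      have h4 := zpow_ne_zero k h2
      field_simp
      ring
  have hlog : ∀ x, 0 < x → HasDerivAt (fun a => logDoubleGamma a v w)
      (-barnesGamma 0 1 x v w) x := fun x hx => by
    have := hζ0' 1 x hx
    simpa [barnesZetaDerivZero, logDoubleGamma] using this
  have hL1 : DifferentiableOn ℂ (fun s => G s α / (s - 2)) (Metric.ball 1 1) := by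
    refine (hGd α hα).differentiableOn.div (by fun_prop) fun s hs => sub_ne_zero.2 ?_
    rintro rfl
    rw [mem_ball_iff_norm] at hs
    norm_num at hs
  have hL2 : DifferentiableOn ℂ (fun s => G s α / (s - 1)) (Metric.ball 2 1) := by
    refine (hGd α hα).differentiableOn.div (by fun_prop) fun s hs => sub_ne_zero.2 ?_
    rintro rfl
    rw [mem_ball_iff_norm] at hs
    norm_num at hs
  refine ⟨hcont α hα, fun s hs0 hs1 => ?_, fun s hs0 hs1 => ?_, fun k => ⟨?_, ?_⟩, ?_, ?_, ⟨?_, ?_⟩,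
    fun k => ?_, fun k hk => ⟨?_, ?_⟩⟩
  · refine hasSum_laurent hL1 (fun s h0 h1 => ?_) hs0 hs1
    rw [hZ α hα s (sub_ne_zero.1 (norm_pos_iff.1 h0)) (by rintro rfl; norm_num at h1), div_div,
      mul_comm]
  · refine hasSum_laurent hL2 (fun s h0 h1 => ?_) hs0 hs1
    rw [hZ α hα s (by rintro rfl; norm_num at h1) (sub_ne_zero.1 (norm_pos_iff.1 h0)), div_div]
  · exact (hζ0' k α hα).differentiableAt
  · rw [(hζ0' k α hα).deriv]
    have : (k.factorial : ℂ) ≠ 0 := by exact_mod_cast k.factorial_ne_zero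
    field_simp
  · have h := contour_coefficient_eq hL1 0
    rw [hγ1 _ α hα]
    simp only [iteratedDeriv_zero, hG1 α hα, Nat.factorial_zero, Nat.cast_one, inv_one,
      one_mul, zero_add, pow_one] at h
    have h2 : (∮ s in C(1, 1 / 2), contourWeight 1 (-1 + 1) s * G s α) =
        ∮ s in C(1, 1 / 2), G s α / (s - 2) / (s - 1) := by
      congr 1
      ext s
      simp only [contourWeight, neg_add_cancel, zpow_zero, mul_one]
      rw [div_div, div_eq_inv_mul, mul_comm (s - 2)]
    rw [h2, h]
    push_cast
    norm_num
    ring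
  · exact log_doubleGamma hα hv hw (hcont α hα)
  · exact (hlog α hα).differentiableAt
  · rw [(hlog α hα).deriv, neg_neg]
  · have hγlog : (fun a => barnesGamma 0 1 a v w) =ᶠ[𝓝 α]
        -deriv (fun a => logDoubleGamma a v w) := by
      filter_upwards [Ioi_mem_nhds hα] with y hy
      rw [Pi.neg_apply, (hlog y hy).deriv, neg_neg]
    have hform : (fun a => logDoubleGamma a v w) =ᶠ[𝓝 α] fun a =>
        ∮ s in C(0, 1 / 2), ((2 * Real.pi * Complex.I)⁻¹ * contourWeight 0 2 s) * G s a := by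
      filter_upwards [Ioi_mem_nhds hα] with y hy
      have := hζ0 1 y hy
      simp only [barnesZetaDerivZero, iteratedDeriv_one, Nat.factorial_one, Nat.cast_one,
        one_mul] at this
      rw [logDoubleGamma, this]
      simp only [mul_assoc, circleIntegral.integral_const_mul]
      norm_num
    refine ⟨?_, ?_⟩
    · exact (hG.differentiableAt_iteratedDeriv_circleIntegral hhalf k
        (continuousOn_const.mul (continuousOn_contourWeight n01 n02 2)) hα).congr_of_eventuallyEq
        (hform.iteratedDeriv k)
    · rw [hγlog.iteratedDeriv_eq k, iteratedDeriv_neg, ← iteratedDeriv_succ', iteratedDeriv_succ]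
      rfl
  · exact (hγ1' k).differentiableAt
  · have hbase : barnesGamma (-2) 2 α v w = 0 := by
      have h0 : (∮ s in C(2, 1 / 2), contourWeight 2 (-2 + 1) s * G s α) =
          ∮ s in C(2, 1 / 2), G s α / (s - 1) := by
        refine circleIntegral.integral_congr hhalf fun s hs => ?_
        have h2 := sub_ne_zero.2 (ne_of_mem_sphere_half hs n22)
        simp only [contourWeight]
        rw [show (-2 + 1 : ℤ) = -1 by norm_num, zpow_neg_one, mul_assoc, mul_inv_cancel₀ h2,
          mul_one, div_eq_inv_mul]
      have hd : DiffContOnCl ℂ (fun s => G s α / (s - 1)) (Metric.ball 2 (1 / 2)) :=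
        hL2.diffContOnCl_ball (Metric.closedBall_subset_ball (by norm_num))
      rw [hγ2 _ α hα, h0, hd.circleIntegral_eq_zero hhalf, mul_zero]
    have hk' : -2 ≤ k := by lia
    clear hk
    induction k, hk' using Int.leInduction with
    | base => simp [hbase]
    | succ k hk ih =>
      have hsplit : Finset.Icc (-1) (k + 1) = insert (k + 1) (Finset.Icc (-1) k) := by
        ext l
        simp only [Finset.mem_Icc, Finset.mem_insert]
        lia
      rw [hsplit, Finset.sum_insert (by simp), (hγ1' (k + 1)).deriv, add_sub_cancel_right,
        sub_self, zero_add, zpow_one]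
      have : ∑ l ∈ Finset.Icc (-1) k, (-1 : ℂ) ^ (k + 1 - l + 1) *
          deriv (fun a : ℝ => barnesGamma l 1 a v w) α = -barnesGamma k 2 α v w := by
        rw [← ih, ← Finset.sum_neg_distrib]
        refine Finset.sum_congr rfl fun l _ => ?_
        rw [show k + 1 - l + 1 = k - l + 1 + 1 by ring, zpow_add_one₀ (by norm_num)]
        ring
      rw [this]
      ring
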